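/- Let $X=\mathbb Z_2^\infty$ be the compact group of sequences $x=(x_1,x_2,\dots)$ of $0$'s and $1$'s under componentwise addition mod $2$, with its Borel (= product) $\sigma$-algebra. Let $\Delta\subset X$ be the subgroup of sequences with finitely many $1$'s, let $\delta^k\in\Delta$ be the sequence whose only $1$ is in position $k$, and let $\check x=x+(1,1,1,\dots)$. For a measure $\mu$ on $X$ put $\check\mu(A)=\mu(\{\check x: x\in A\})$. Two measures are called equivalent if each is absolutely continuous with respect to the other. A triple $(\mu,\mathcal V,\mathcal C)$ consists of the following data. * A $\sigma$-finite positive Borel measure $\mu$ on $X$ which is quasi-invariant under $\Delta$, i.e. for every $\delta\in\Delta$ the measure $A\mapsto\mu(A+\delta)$ is equivalent to $\mu$. * A measurable field $\mathcal V=\{V_x\}_{x\in X}$ of closed subspaces of a separable complex Hilbert space $K$, nonzero for almost all $x$, such that for every $\delta\in\Delta$, $V_{x+\delta}=V_x$ for almost all $x$. Measurability means that $x\mapsto P_{V_x}v$ is measurable for every $v\in K$, where $P_{V_x}$ is the orthogonal projection onto $V_x$. Put $\nu(x)=\dim V_x\in\{0,1,2,\dots,\infty\}$ (Hilbert dimension)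 and $\check\nu(x)=\nu(\check x)$. * A family $\mathcal C=\{c_k(x): k\ge 1,\ x\in X\}$ of operators, depending measurably on $x$, such that for almost all $x$ and all $k,l$ the operator $c_k(x):V_x\to V_x$ is unitary and $$c_k(x)^*=c_k(x+\delta^k),\qquad c_k(x)\,c_l(x+\delta^k)=c_l(x)\,c_k(x+\delta^l).$$ Let $V=V(\mu,\nu,\mathcal C)=\int_X^{\oplus}V_x\,d\mu(x)$ be the Hilbert space of square-integrable sections, and let the Clifford algebra act on $V$ through its generators $$J_kf(x)=-i(-1)^{x_1+\dots+x_{k-1}}c_k(x)\Big(\sqrt{\tfrac{d\mu(x+\delta^k)}{d\mu(x)}}\,f(x+\delta^k)\Big),\qquad J_k'f(x)=(-1)^{x_1+\dots+x_k}c_k(x)\Big(\sqrt{\tfrac{d\mu(x+\delta^k)}{d\mu(x)}}\,f(x+\delta^k)\Big),\qquad k\ge 1.$$ An invariant quaternionic structure on $V$ is a $\mathbb C$-antilinear map $Q:V\to V$ with $\|Qf\|=\|f\|$ for all $f\in V$, $Q^2=-1$, and $QJ_k=J_kQ$, $QJ'_k=J'_kQ$ for all $k\ge1$. **Theorem 3.10.**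 $V(\mu,\nu,\mathcal C)$ admits an invariant quaternionic structure if and only if $\mu$ and $\check\mu$ are equivalent, $\check\nu(x)=\nu(x)$ for almost all $x\in X$, and there exists a measurable family of operators $q(x)$, $x\in X$, which for almost all $x$ are $\mathbb C$-antilinear norm-preserving maps $q(x):V_{\check x}\to V_x$ and satisfy $$q(x)\,q(\check x)=-1\ \text{ on } V_x,\qquad q(x)\,c_k(\check x)=(-1)^k\,c_k(x)\,q(x+\delta^k)\ \text{ on } V_{\check x}$$ for all $k\ge 1$ and almost all $x\in X$. -/

import Mathlib

open MeasureTheory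
open scoped ENNReal

noncomputable section

namespace Spinor

universe u

/-- The group `X = ℤ₂^∞` of sequences `x = (x₁, x₂, …)` of zeros and ones, indexed by the positive
integers, with componentwise addition modulo `2` and the product (= Borel) σ-algebra. -/
abbrev X : Type := ℕ+ → ZMod 2

/-- The subset `Δ ⊆ X` of sequences with only finitely many ones. -/
def Delta : Set X := {d | {k : ℕ+ | d k ≠ 0}.Finite}

/-- The generator `δᵏ` of `Δ`, with components the Kronecker symbols. -/
def delta (k : ℕ+) : X := Pi.single k 1

/-- The involution `x ↦ x̌ = x + 𝟏`, which exchanges zeros and ones. -/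
def check (x : X) : X := x + 1

/-- Two measures are equivalent if each is absolutely continuous with respect to the other. For
`σ`-finite measures this is the existence of both Radon-Nikodym derivatives. -/
def MeasEquiv (μ ν : Measure X) : Prop := μ ≪ ν ∧ ν ≪ μ

/-- The translated measure `A ↦ μ (A + d)`. Since `d + d = 0` in `X`, the set `A + d` is the
preimage of `A` under `x ↦ x + d`. -/
def translate (μ : Measure X) (d : X) : Measure X := μ.map (fun x => x + d)

/-- The measure `μ̌ (A) = μ (Ǎ)`. Since `check` is an involution, `Ǎ` is the preimage of `A`. -/
def checkMeasure (μ : Measure X) : Measure X := μ.map check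

/-- A triple `(μ, 𝒱, 𝒞)`. The measurable field `𝒱` of Hilbert spaces is given by closed
subspaces `V x` of an ambient Hilbert space `K` (in the theorem, `K` is separable), and `c k x`
matters only through its restriction to `V x`: the values of `c k x` off `V x` play no role. -/
structure Triple (K : Type u) [NormedAddCommGroup K] [InnerProductSpace ℂ K]
    [CompleteSpace K] where
  /-- the measure -/
  μ : Measure X
  sigmaFinite : SigmaFinite μ
  /-- quasi-invariance under `Δ` -/
  quasiInvariant : ∀ d ∈ Delta, MeasEquiv (translate μ d) μ
  /-- the field of Hilbert spaces -/
  V : X → ClosedSubmodule ℂ K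
  /-- The field is measurable; in particular `x ↦ dim (V x)` is measurable. -/
  measurable_V : ∀ v : K, StronglyMeasurable fun x => (V x).toSubmodule.starProjection v
  /-- almost all fibres are nonzero -/
  nonzero : ∀ᵐ x ∂μ, ∃ v ∈ V x, v ≠ 0
  /-- the field is a.e. invariant under translations by `Δ` -/
  invariant : ∀ d ∈ Delta, ∀ᵐ x ∂μ, V (x + d) = V x
  /-- the operators `c k x : V x → V x` -/
  c : ℕ+ → X → K →L[ℂ] K
  /-- `c k x` depends measurably on `x` -/
  measurable_c : ∀ (k : ℕ+) (v : K),
    StronglyMeasurable fun x => c k x ((V x).toSubmodule.starProjection v)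
  /-- `c k x` is unitary: it maps `V x` isometrically onto `V x` -/
  isometric : ∀ k, ∀ᵐ x ∂μ, ∀ v ∈ V x, ‖c k x v‖ = ‖v‖
  onto : ∀ k, ∀ᵐ x ∂μ, (V x).toSubmodule.map (c k x : K →ₗ[ℂ] K) = (V x).toSubmodule
  /-- `c k x ^* = c k (x + δᵏ)` -/
  adjoint : ∀ k, ∀ᵐ x ∂μ, ∀ v ∈ V x, ∀ w ∈ V x,
    inner ℂ (c k x v) w = inner ℂ v (c k (x + delta k) w)
  /-- `c k x c l (x + δᵏ) = c l x c k (x + δˡ)` -/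
  cocycle : ∀ k l, ∀ᵐ x ∂μ, ∀ v ∈ V x,
    c k x (c l (x + delta k) v) = c l x (c k (x + delta l) v)

attribute [instance] Triple.sigmaFinite

namespace Triple

variable {K : Type u} [NormedAddCommGroup K] [InnerProductSpace ℂ K] [CompleteSpace K]

/-- The dimension function `ν x = dim (V x)`, with values in `{0, 1, 2, …, ∞}`. -/
def ν (T : Triple K) (x : X) : ℕ∞ := Cardinal.toENat (Module.rank ℂ (T.V x).toSubmodule)

/-- The Hilbert space `V(μ, ν, 𝒞)`, i.e. the direct integral of the `V x`: the space of
`μ`-square-integrable sections `f`, `f x ∈ V x`, modulo equality almost everywhere, with the norm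
of `L²(X, μ; K)`. -/
def Space (T : Triple K) : Submodule ℂ (Lp K 2 T.μ) where
  carrier := {f | ∀ᵐ x ∂T.μ, f x ∈ T.V x}
  zero_mem' := by
    filter_upwards [Lp.coeFn_zero K 2 T.μ] with x hx
    rw [hx]
    exact (T.V x).toSubmodule.zero_mem
  add_mem' := by
    intro f g hf hg
    change ∀ᵐ x ∂T.μ, (f + g : Lp K 2 T.μ) x ∈ T.V x
    change ∀ᵐ x ∂T.μ, f x ∈ T.V x at hf
    change ∀ᵐ x ∂T.μ, g x ∈ T.V x at hg
    filter_upwards [Lp.coeFn_add f g, hf, hg] with x hx h1 h2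
    rw [hx]
    exact (T.V x).toSubmodule.add_mem h1 h2
  smul_mem' := by
    intro a f hf
    change ∀ᵐ x ∂T.μ, (a • f : Lp K 2 T.μ) x ∈ T.V x
    change ∀ᵐ x ∂T.μ, f x ∈ T.V x at hf
    filter_upwards [Lp.coeFn_smul a f, hf] with x hx h1
    rw [hx]
    exact (T.V x).toSubmodule.smul_mem a h1

/-- The Radon-Nikodym derivative `dμ(x + δᵏ) / dμ(x)`. -/
def density (T : Triple K) (k : ℕ+) (x : X) : ℝ :=
  ((translate T.μ (delta k)).rnDeriv T.μ x).toReal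

/-- The section `x ↦ ε(x) c_k(x) (√(dμ(x + δᵏ)/dμ(x)) f(x + δᵏ))`, for a scalar function `ε`. -/
def shift (T : Triple K) (ε : X → ℂ) (k : ℕ+) (f : X → K) (x : X) : K :=
  ε x • T.c k x (((Real.sqrt (T.density k x) : ℝ) : ℂ) • f (x + delta k))

end Triple

/-- The phase `-i (-1)^(x₁ + ⋯ + x_{k-1})`. -/
def phase (k : ℕ+) (x : X) : ℂ := -Complex.I * (-1) ^ (∑ j ∈ Finset.Iio k, (x j).val)

/-- The phase `(-1)^(x₁ + ⋯ + x_k)`. -/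
def phase' (k : ℕ+) (x : X) : ℂ := (-1) ^ (∑ j ∈ Finset.Iic k, (x j).val)

theorem delta_mem (k : ℕ+) : delta k ∈ Delta := by
  refine (Set.finite_singleton k).subset ?_
  intro j hj
  by_contra h
  exact hj (by simp [delta, Pi.single_eq_of_ne h])

theorem measurable_add_right' (d : X) : Measurable (fun x : X => x + d) := by
  refine measurable_pi_iff.2 fun j => ?_
  exact (measurable_from_top (f := fun t : ZMod 2 => t + d j)).comp (measurable_pi_apply j)

theorem measurable_sign (s : Finset ℕ+) :
    Measurable (fun x : X => ((-1 : ℂ)) ^ (∑ j ∈ s, (x j).val)) := by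
  have h : Measurable (fun x : X => ∑ j ∈ s, (x j).val) :=
    Finset.measurable_fun_sum s fun j _ =>
      (measurable_from_top (f := fun t : ZMod 2 => t.val)).comp (measurable_pi_apply j)
  exact (measurable_from_top (f := fun n : ℕ => (-1 : ℂ) ^ n)).comp h

theorem measurable_phase (k : ℕ+) : Measurable (phase k) :=
  (measurable_sign _).const_mul _

theorem measurable_phase' (k : ℕ+) : Measurable (phase' k) :=
  measurable_sign _

theorem norm_phase (k : ℕ+) (x : X) : ‖phase k x‖ = 1 := by
  simp [phase]

theorem norm_phase' (k : ℕ+) (x : X) : ‖phase' k x‖ = 1 := by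
  simp [phase']

namespace Triple

variable {K : Type u} [NormedAddCommGroup K] [InnerProductSpace ℂ K] [CompleteSpace K]

theorem quasiMeasurePreserving (T : Triple K) (k : ℕ+) :
    Measure.QuasiMeasurePreserving (fun x : X => x + delta k) T.μ T.μ :=
  ⟨measurable_add_right' _, (T.quasiInvariant _ (delta_mem k)).1⟩

theorem sections_add (T : Triple K) (k : ℕ+) (f : T.Space) :
    ∀ᵐ x ∂T.μ, (f : Lp K 2 T.μ) (x + delta k) ∈ T.V x := by
  filter_upwards [(T.quasiMeasurePreserving k).ae f.2, T.invariant _ (delta_mem k)] with x h1 h2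
  rw [← h2]
  exact h1

theorem shift_aestronglyMeasurable [SecondCountableTopology K] (T : Triple K) {ε : X → ℂ}
    (hε : Measurable ε) (k : ℕ+) (f : T.Space) :
    AEStronglyMeasurable (T.shift ε k (f : Lp K 2 T.μ)) T.μ := by
  borelize K
  have hu : StronglyMeasurable (Function.uncurry fun (v : K) (x : X) =>
      T.c k x ((T.V x).toSubmodule.starProjection v)) :=
    stronglyMeasurable_uncurry_of_continuous_of_stronglyMeasurable
      (fun x => (T.c k x).continuous.comp (T.V x).toSubmodule.starProjection.continuous)
      (T.measurable_c k)
  set g : X → K := ⇑(f : Lp K 2 T.μ) with hg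
  have hgm : StronglyMeasurable g := Lp.stronglyMeasurable _
  have hd : Measurable fun x => ((Real.sqrt (T.density k x) : ℝ) : ℂ) :=
    Complex.measurable_ofReal.comp
      ((Measure.measurable_rnDeriv _ _).ennreal_toReal.sqrt)
  have hs : StronglyMeasurable fun x =>
      ((Real.sqrt (T.density k x) : ℝ) : ℂ) • g (x + delta k) :=
    hd.stronglyMeasurable.smul (hgm.comp_measurable (measurable_add_right' (delta k)))
  have h : StronglyMeasurable fun x => ε x • T.c k x ((T.V x).toSubmodule.starProjection
      (((Real.sqrt (T.density k x) : ℝ) : ℂ) • g (x + delta k))) :=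
    hε.stronglyMeasurable.smul (hu.comp_measurable (hs.measurable.prodMk measurable_id))
  refine ⟨_, h, ?_⟩
  filter_upwards [T.sections_add k f] with x hx
  rw [Submodule.starProjection_eq_self_iff.2 ((T.V x).toSubmodule.smul_mem _ hx)]
  rfl

theorem shift_memLp [SecondCountableTopology K] (T : Triple K) {ε : X → ℂ}
    (hε : Measurable ε) (hn : ∀ x, ‖ε x‖ = 1) (k : ℕ+) (f : T.Space) :
    MemLp (T.shift ε k (f : Lp K 2 T.μ)) 2 T.μ := by
  refine ⟨T.shift_aestronglyMeasurable hε k f, ?_⟩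
  have hf := (Lp.memLp (f : Lp K 2 T.μ)).2
  set g : X → K := ⇑(f : Lp K 2 T.μ) with hg
  have hgm : StronglyMeasurable g := Lp.stronglyMeasurable _
  rw [eLpNorm_lt_top_iff_lintegral_rpow_enorm_lt_top two_ne_zero ENNReal.ofNat_ne_top] at hf ⊢
  have hqi := T.quasiInvariant _ (delta_mem k)
  have hshift : Measurable (fun x : X => x + delta k) := measurable_add_right' _
  have : SigmaFinite (translate T.μ (delta k)) := by
    exact MeasurableEquiv.sigmaFinite_map
      (f := { toFun := fun x => x + delta k
              invFun := fun x => x + -delta k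
              left_inv := fun x => by simp
              right_inv := fun x => by simp
              measurable_toFun := hshift
              measurable_invFun := measurable_add_right' _ })
  have hinv : ∀ x : X, x + delta k + delta k = x := by
    intro x
    rw [add_assoc]
    have : delta k + delta k = 0 := by
      ext j
      simp [CharTwo.add_self_eq_zero]
    rw [this, add_zero]
  have hm : Measurable fun x => ‖g x‖ₑ ^ (2 : ℝ≥0∞).toReal := hgm.enorm.pow_const _
  have key : ∫⁻ x, ‖T.shift ε k g x‖ₑ ^ (2 : ℝ≥0∞).toReal ∂T.μ
      = ∫⁻ x, ‖g x‖ₑ ^ (2 : ℝ≥0∞).toReal ∂T.μ := by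
    calc _ = ∫⁻ x, (translate T.μ (delta k)).rnDeriv T.μ x *
            (‖g (x + delta k)‖ₑ ^ (2 : ℝ≥0∞).toReal) ∂T.μ := by
          refine lintegral_congr_ae ?_
          filter_upwards [T.sections_add k f, T.isometric k,
            Measure.rnDeriv_lt_top (translate T.μ (delta k)) T.μ] with x h1 h2 h3
          have hnorm : ‖T.shift ε k g x‖ = Real.sqrt (T.density k x) * ‖g (x + delta k)‖ := by
            rw [shift, norm_smul, hn, one_mul,
              h2 _ ((T.V x).toSubmodule.smul_mem _ h1), norm_smul, Complex.norm_real,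
              Real.norm_of_nonneg (Real.sqrt_nonneg _)]
          have h0 : (0 : ℝ) ≤ T.density k x := ENNReal.toReal_nonneg
          rw [← ofReal_norm, hnorm, ENNReal.ofReal_mul (Real.sqrt_nonneg _),
            ofReal_norm, ENNReal.toReal_ofNat, ENNReal.rpow_ofNat, mul_pow,
            ← ENNReal.ofReal_pow (Real.sqrt_nonneg _), Real.sq_sqrt h0, density,
            ENNReal.ofReal_toReal h3.ne, ENNReal.rpow_ofNat]
      _ = ∫⁻ x, ‖g (x + delta k)‖ₑ ^ (2 : ℝ≥0∞).toReal ∂(translate T.μ (delta k)) :=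
          lintegral_rnDeriv_mul hqi.1 (hm.comp hshift).aemeasurable
      _ = ∫⁻ x, ‖g (x + delta k + delta k)‖ₑ ^ (2 : ℝ≥0∞).toReal ∂T.μ :=
          lintegral_map (hm.comp hshift) hshift
      _ = _ := by simp only [hinv]
  rw [key]
  exact hf

theorem shift_mem [SecondCountableTopology K] (T : Triple K) {ε : X → ℂ}
    (hε : Measurable ε) (hn : ∀ x, ‖ε x‖ = 1) (k : ℕ+) (f : T.Space) :
    (T.shift_memLp hε hn k f).toLp _ ∈ T.Space := by
  change ∀ᵐ x ∂T.μ, _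
  filter_upwards [(T.shift_memLp hε hn k f).coeFn_toLp, T.sections_add k f, T.onto k]
    with x h1 h2 h3
  rw [h1]
  have h4 : T.c k x (((Real.sqrt (T.density k x) : ℝ) : ℂ) • (f : Lp K 2 T.μ) (x + delta k))
      ∈ (T.V x).toSubmodule.map (T.c k x : K →ₗ[ℂ] K) :=
    Submodule.mem_map_of_mem ((T.V x).toSubmodule.smul_mem _ h2)
  rw [h3] at h4
  exact (T.V x).toSubmodule.smul_mem _ h4

/-- The operator `J_k` on `V(μ, ν, 𝒞)`:
`J_k f(x) = -i (-1)^(x₁ + ⋯ + x_{k-1}) c_k(x) (√(dμ(x + δᵏ)/dμ(x)) f(x + δᵏ))`. -/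
def J [SecondCountableTopology K] (T : Triple K) (k : ℕ+) (f : T.Space) : T.Space :=
  ⟨(T.shift_memLp (measurable_phase k) (norm_phase k) k f).toLp _,
    T.shift_mem (measurable_phase k) (norm_phase k) k f⟩

/-- The operator `J'_k` on `V(μ, ν, 𝒞)`:
`J'_k f(x) = (-1)^(x₁ + ⋯ + x_k) c_k(x) (√(dμ(x + δᵏ)/dμ(x)) f(x + δᵏ))`. -/
def J' [SecondCountableTopology K] (T : Triple K) (k : ℕ+) (f : T.Space) : T.Space :=
  ⟨(T.shift_memLp (measurable_phase' k) (norm_phase' k) k f).toLp _,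
    T.shift_mem (measurable_phase' k) (norm_phase' k) k f⟩

/-- An invariant quaternionic structure on `V(μ, ν, 𝒞)`: an antilinear, norm-preserving operator
`Q` with `Q² = -1` which commutes with the action of the Clifford algebra, i.e. with its
generators `J_1, J'_1, J_2, J'_2, …`. -/
structure IsInvariantQuaternionicStructure [SecondCountableTopology K] (T : Triple K)
    (Q : T.Space →ₗ⋆[ℂ] T.Space) : Prop where
  norm_map : ∀ f, ‖Q f‖ = ‖f‖
  sq : ∀ f, Q (Q f) = -f
  comm : ∀ k f, Q (T.J k f) = T.J k (Q f)
  comm' : ∀ k f, Q (T.J' k f) = T.J' k (Q f)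

/-- A measurable family of antilinear norm-preserving operators `q x : V x̌ → V x` satisfying
`q(x) q(x̌) = -1` and `q(x) c_k(x̌) = (-1)^k c_k(x) q(x + δᵏ)`, almost everywhere. As for the
`c k x`, only the restriction of `q x` to the fibre is relevant. -/
structure IsQuaternionicField (T : Triple K) (q : X → K →L⋆[ℂ] K) : Prop where
  measurable : ∀ v : K,
    StronglyMeasurable fun x => q x ((T.V (check x)).toSubmodule.starProjection v)
  mapsTo : ∀ᵐ x ∂T.μ, ∀ v ∈ T.V (check x), q x v ∈ T.V x
  norm_map : ∀ᵐ x ∂T.μ, ∀ v ∈ T.V (check x), ‖q x v‖ = ‖v‖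
  mul_check : ∀ᵐ x ∂T.μ, ∀ v ∈ T.V x, q x (q (check x) v) = -v
  intertwine : ∀ k : ℕ+, ∀ᵐ x ∂T.μ, ∀ v ∈ T.V (check x),
    q x (T.c k (check x) v) = (-1 : ℂ) ^ (k : ℕ) • T.c k x (q (x + delta k) v)

end Triple

end Spinor

end

/-! Everything rests on a correspondence between `Q` and `q`: `Q f(x) = q(x) (w(x) f(x̌))`, where
`w` is the square root of `dμ̌/dμ`.

From `q` to `Q`: the factor `w` makes this operator norm-preserving, `w(x) w(x̌) = 1` together with
`q(x) q(x̌) = -1` gives `Q² = -1`, and commutation with the generators holds because the sign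
`(-1)^k` of the intertwining relation is exactly the one produced by conjugating the phase at `x̌`
(`transport_shift`).

From `Q` to `q`: the product `J_k J'_k` is multiplication by `i (-1)^(x_k)` (`J_J'`). An antilinear
`Q` commuting with it anticommutes with `(-1)^(x_k)`, hence carries sections supported on `x_k = 0`
to sections supported on `x_k = 1` and conversely. Intersecting cylinders and using that `Q`
preserves norms, the measure `‖Q f‖² μ` is the image of `‖f‖² μ` under `check` (`measure_eq`).
Testing on sections that span the fibres gives `μ ~ μ̌`, comparing densities gives `‖Q f(x)‖ = w(x)
‖f(x̌)‖`, and polarization gives the inner products. The values of `Q` on countably many spanning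
sections therefore have the Gram matrix needed to define `q(x)` fibre by fibre
(`exists_fibre_operators`). The relations for `q` are then read off from those for `Q`, and equality
of dimensions follows from the isometries `q(x)` and `q(x̌)`. -/

open MeasureTheory
open scoped ENNReal

noncomputable section

namespace Spinor

universe u

/-! ### Radon-Nikodym weights of involutions. -/

section Weight

variable {Ω : Type*} [MeasurableSpace Ω] {μ : Measure Ω} {τ σ : Ω → Ω}

/-- The square root of the Radon-Nikodym derivative of the image of `μ` under `τ`. -/
def weight (μ : Measure Ω) (τ : Ω → Ω) (x : Ω) : ℝ := √((μ.map τ).rnDeriv μ x).toReal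

theorem measurable_weight (μ : Measure Ω) (τ : Ω → Ω) : Measurable (weight μ τ) :=
  (Measure.measurable_rnDeriv _ _).ennreal_toReal.sqrt

theorem sigmaFinite_map_of_involutive [SigmaFinite μ] (hτ : Measurable τ)
    (hi : Function.Involutive τ) : SigmaFinite (μ.map τ) :=
  MeasurableEquiv.sigmaFinite_map (f := MeasurableEquiv.ofInvolutive τ hi hτ)

theorem lintegral_rnDeriv_map_mul [SigmaFinite μ] (hτ : Measurable τ)
    (hi : Function.Involutive τ) (hac : μ.map τ ≪ μ) {φ : Ω → ℝ≥0∞} (hφ : Measurable φ) :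
    ∫⁻ x, (μ.map τ).rnDeriv μ x * φ (τ x) ∂μ = ∫⁻ x, φ x ∂μ := by
  have := sigmaFinite_map_of_involutive (μ := μ) hτ hi
  calc ∫⁻ x, (μ.map τ).rnDeriv μ x * φ (τ x) ∂μ
      = ∫⁻ x, φ (τ x) ∂(μ.map τ) := lintegral_rnDeriv_mul hac (hφ.comp hτ).aemeasurable
    _ = ∫⁻ x, φ (τ (τ x)) ∂μ := lintegral_map (hφ.comp hτ) hτ
    _ = ∫⁻ x, φ x ∂μ := by simp only [hi _]

/-- Chain rule: the image of `μ` under `τ ∘ σ` gives `s` the mass `∫ dσ_*μ/dμ` over `τ⁻¹ s`, and the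
change of variables by `τ` moves this integral to `s`. Taking `σ = τ` yields `w(x) w(τ x) = 1`;
commuting involutions yield a cocycle identity. -/
theorem rnDeriv_map_comp [SigmaFinite μ] (hτ : Measurable τ) (hi : Function.Involutive τ)
    (hac : μ.map τ ≪ μ) (hσ : Measurable σ) (hσi : Function.Involutive σ)
    (hσac : μ.map σ ≪ μ) :
    (μ.map (τ ∘ σ)).rnDeriv μ
      =ᵐ[μ] fun x => (μ.map τ).rnDeriv μ x * (μ.map σ).rnDeriv μ (τ x) := by
  have h1 := sigmaFinite_map_of_involutive (μ := μ) hτ hi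
  have h2 := sigmaFinite_map_of_involutive (μ := μ) hσ hσi
  have hm : Measurable fun x => (μ.map τ).rnDeriv μ x * (μ.map σ).rnDeriv μ (τ x) :=
    (Measure.measurable_rnDeriv _ _).mul ((Measure.measurable_rnDeriv _ _).comp hτ)
  have : μ.map (τ ∘ σ) = μ.withDensity
      (fun x => (μ.map τ).rnDeriv μ x * (μ.map σ).rnDeriv μ (τ x)) := by
    ext s hs
    rw [withDensity_apply _ hs, ← Measure.map_map hτ hσ, Measure.map_apply hτ hs,
      ← Measure.withDensity_rnDeriv_eq _ _ hσac, withDensity_apply _ (hτ hs),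
      ← lintegral_indicator (hτ hs), ← lintegral_indicator hs,
      ← lintegral_rnDeriv_map_mul hτ hi hac
        ((Measure.measurable_rnDeriv _ _).indicator (hτ hs))]
    refine lintegral_congr fun x => ?_
    -- The backward rewrite of `μ.map σ` also hit the density integrated over `s`; this restores it.
    rw [Measure.withDensity_rnDeriv_eq _ _ hσac]
    by_cases hx : x ∈ s <;> simp [Set.indicator, hi x, hx]
  rw [this]
  exact Measure.rnDeriv_withDensity μ hm

theorem weight_comp [SigmaFinite μ] (hτ : Measurable τ) (hi : Function.Involutive τ)
    (hac : μ.map τ ≪ μ) (hσ : Measurable σ) (hσi : Function.Involutive σ)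
    (hσac : μ.map σ ≪ μ) :
    ∀ᵐ x ∂μ, weight μ (τ ∘ σ) x = weight μ τ x * weight μ σ (τ x) := by
  filter_upwards [rnDeriv_map_comp hτ hi hac hσ hσi hσac] with x hx
  rw [weight, hx, ENNReal.toReal_mul, Real.sqrt_mul ENNReal.toReal_nonneg, weight, weight]

theorem weight_mul_weight_apply [SigmaFinite μ] (hτ : Measurable τ)
    (hi : Function.Involutive τ) (hac : μ.map τ ≪ μ) :
    ∀ᵐ x ∂μ, weight μ τ x * weight μ τ (τ x) = 1 := by
  filter_upwards [weight_comp hτ hi hac hτ hi hac, Measure.rnDeriv_self μ] with x hx h1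
  rw [← hx, weight, show τ ∘ τ = id from funext hi, Measure.map_id, h1]
  simp

theorem weight_nonneg (μ : Measure Ω) (τ : Ω → Ω) (x : Ω) : 0 ≤ weight μ τ x := Real.sqrt_nonneg _

theorem ofReal_weight_sq [SigmaFinite μ] (hτ : Measurable τ) (hi : Function.Involutive τ) :
    ∀ᵐ x ∂μ, ENNReal.ofReal (weight μ τ x) ^ 2 = (μ.map τ).rnDeriv μ x := by
  have := sigmaFinite_map_of_involutive (μ := μ) hτ hi
  filter_upwards [Measure.rnDeriv_lt_top (μ.map τ) μ] with x hx
  rw [← ENNReal.ofReal_pow (weight_nonneg _ _ _), weight, Real.sq_sqrt ENNReal.toReal_nonneg,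
    ENNReal.ofReal_toReal hx.ne]

/-- The transport of a function by an involution, twisted by norm-preserving maps, preserves the
`L²`-norm. -/
theorem eLpNorm_two_eq_of_norm_eq_weight_mul {E : Type*} [NormedAddCommGroup E] [SigmaFinite μ]
    (hτ : Measurable τ) (hi : Function.Involutive τ) (hac : μ.map τ ≪ μ) {f g : Ω → E}
    (hf : StronglyMeasurable f) (hg : ∀ᵐ x ∂μ, ‖g x‖ = weight μ τ x * ‖f (τ x)‖) :
    eLpNorm g 2 μ = eLpNorm f 2 μ := by
  rw [eLpNorm_eq_lintegral_rpow_enorm_toReal two_ne_zero ENNReal.ofNat_ne_top,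
    eLpNorm_eq_lintegral_rpow_enorm_toReal two_ne_zero ENNReal.ofNat_ne_top,
    ← lintegral_rnDeriv_map_mul hτ hi hac (hf.enorm.pow_const _)]
  congr 1
  refine lintegral_congr_ae ?_
  filter_upwards [hg, ofReal_weight_sq (μ := μ) hτ hi] with x hx h1
  rw [← ofReal_norm, hx, ENNReal.ofReal_mul (weight_nonneg _ _ _), ofReal_norm, ← h1,
    ENNReal.toReal_ofNat, ENNReal.rpow_ofNat, ENNReal.rpow_ofNat, mul_pow]

end Weight

/-! ### Antilinear isometries and Gram matrices. -/

section Antilinear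

variable {K : Type*} [NormedAddCommGroup K] [InnerProductSpace ℂ K]

/-- An antilinear operator with prescribed values `F i` on a total family `s i` exists as soon as
the Gram matrix of `F` is the conjugate of the Gram matrix of a projection of `s`. -/
theorem exists_antilinear_of_gram [CompleteSpace K] {ι : Type*} {s F : ι → K}
    (hs : DenseRange s) (P : K →L[ℂ] K)
    (hP : ∀ v, ‖P v‖ ≤ ‖v‖)
    (h : ∀ i j, inner ℂ (F i) (F j) = inner ℂ (P (s j)) (P (s i))) :
    ∃ L : K →L⋆[ℂ] K, (∀ i, L (s i) = F i) ∧ ∀ v, ‖L v‖ = ‖P v‖ := by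
  let e : (ι →₀ ℂ) →ₗ[ℂ] K := Finsupp.linearCombination ℂ s
  let f : (ι →₀ ℂ) →ₗ⋆[ℂ] K :=
    { toFun := fun a => a.sum fun i z => (starRingEnd ℂ z) • F i
      map_add' := fun a b => Finsupp.sum_add_index' (by simp) (by simp [add_smul])
      map_smul' := fun z a => by
        rw [Finsupp.sum_smul_index' (by simp), Finsupp.smul_sum]
        simp [mul_smul] }
  -- On formal combinations the Gram hypothesis gives equality of norms. Since `P` is a contraction,
  -- `f` is bounded by `e`, so it factors through the dense range of `e` and extends by continuity.
  have hnorm : ∀ a, ‖f a‖ = ‖P (e a)‖ := by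
    intro a
    have h2 : inner ℂ (f a) (f a) = inner ℂ (P (e a)) (P (e a)) := by
      change inner ℂ (∑ i ∈ a.support, _) (∑ i ∈ a.support, _)
        = inner ℂ (P (∑ i ∈ a.support, _)) (P (∑ i ∈ a.support, _))
      simp only [map_sum, sum_inner, inner_sum]
      rw [Finset.sum_comm]
      refine Finset.sum_congr rfl fun i _ => Finset.sum_congr rfl fun j _ => ?_
      simp [inner_smul_left, inner_smul_right, h]
      ring
    rw [inner_self_eq_norm_sq_to_K, inner_self_eq_norm_sq_to_K] at h2
    have h3 : ‖f a‖ ^ 2 = ‖P (e a)‖ ^ 2 := by exact_mod_cast h2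
    exact (pow_left_inj₀ (norm_nonneg _) (norm_nonneg _) two_ne_zero).1 h3
  have hd : DenseRange e := hs.mono (by
    rintro _ ⟨i, rfl⟩
    exact ⟨Finsupp.single i 1, by simp [e]⟩)
  have hb : ∀ a, ‖f a‖ ≤ 1 * ‖e a‖ := fun a => by rw [hnorm, one_mul]; exact hP _
  have he : ∀ a, f.extendOfNorm e (e a) = f a := LinearMap.extendOfNorm_eq hd ⟨1, hb⟩
  refine ⟨f.extendOfNorm e, fun i => ?_, fun v => ?_⟩
  · have := he (Finsupp.single i 1)
    simpa [e, f] using this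
  · refine hd.induction_on (p := fun v => ‖f.extendOfNorm e v‖ = ‖P v‖) v
      (isClosed_eq (by fun_prop) (by fun_prop)) fun a => ?_
    rw [he, hnorm]

/-- Polarization for an antilinear isometry: `I` changes sign between the two sides, which
conjugates the inner product and so swaps its arguments. -/
theorem inner_eq_inner_swap_of_norm_eq {a b v w : K} (h1 : ‖a + b‖ = ‖v + w‖)
    (h2 : ‖a - b‖ = ‖v - w‖) (h3 : ‖a - Complex.I • b‖ = ‖v + Complex.I • w‖)
    (h4 : ‖a + Complex.I • b‖ = ‖v - Complex.I • w‖) : inner ℂ a b = inner ℂ w v := by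
  have hI : (RCLike.I : ℂ) = Complex.I := rfl
  have hc : (starRingEnd ℂ) 4 = 4 := map_ofNat _ 4
  rw [← inner_conj_symm w v, inner_eq_sum_norm_sq_div_four a b,
    inner_eq_sum_norm_sq_div_four v w, hI, h1, h2, h3, h4]
  simp [hc]
  ring

theorem rank_le_of_antilinear_isometry {q : K →L⋆[ℂ] K} {S S' : Submodule ℂ K}
    (hm : ∀ v ∈ S, q v ∈ S') (h : ∀ v ∈ S, ‖q v‖ = ‖v‖) :
    Module.rank ℂ S ≤ Module.rank ℂ S' := by
  refine rank_le_of_injective_injective (starRingEnd ℂ)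
    (((q : K →+ K).comp S.subtype.toAddMonoidHom).codRestrict S'.toAddSubmonoid
      fun v => hm v v.2) (by simp) ?_ ?_
  · rw [injective_iff_map_eq_zero]
    intro v hv
    have h0 : q (v : K) = 0 := congrArg (fun w : S' => (w : K)) hv
    have := h v v.2
    rw [h0, norm_zero] at this
    exact Subtype.ext (norm_eq_zero.1 this.symm)
  · intro r m
    refine Subtype.ext ?_
    change q ((starRingEnd ℂ r) • (m : K)) = r • q (m : K)
    simp [map_smulₛₗ]

end Antilinear

/-! ### The involution `check` and its effect on the phases. -/

theorem measurable_check : Measurable check := measurable_add_right' 1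

theorem add_delta_add_delta (x : X) (k : ℕ+) : x + delta k + delta k = x := by
  rw [add_assoc, show delta k + delta k = 0 from by ext j; simp [CharTwo.add_self_eq_zero],
    add_zero]

theorem check_check (x : X) : check (check x) = x := by
  rw [check, check, add_assoc, show (1 : X) + 1 = 0 from funext fun _ => (by decide : (1 : ZMod 2) + 1 = 0), add_zero]

theorem check_involutive : Function.Involutive check := check_check

theorem add_delta_involutive (k : ℕ+) : Function.Involutive (fun x : X => x + delta k) :=
  fun x => add_delta_add_delta x k

theorem check_add_delta (x : X) (k : ℕ+) : check (x + delta k) = check x + delta k :=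
  add_right_comm _ _ _

theorem sign_check (s : Finset ℕ+) (x : X) :
    (-1 : ℂ) ^ (∑ j ∈ s, (check x j).val) = (-1) ^ s.card * (-1) ^ (∑ j ∈ s, (x j).val) := by
  have h : ∀ a : ZMod 2, (-1 : ℂ) ^ (a + 1).val = (-1) * (-1) ^ a.val := by
    intro a
    have h2 : ∀ a : ZMod 2, (a + 1).val + a.val = 1 := by decide
    have h3 : ∀ m n : ℕ, m + n = 1 → (-1 : ℂ) ^ m = -1 * (-1) ^ n := by
      intro m n h
      obtain ⟨rfl, rfl⟩ | ⟨rfl, rfl⟩ := Nat.add_eq_one_iff.1 h <;> simp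
    exact h3 _ _ (h2 a)
  rw [← Finset.prod_pow_eq_pow_sum, ← Finset.prod_pow_eq_pow_sum, ← Finset.prod_const,
    ← Finset.prod_mul_distrib]
  exact Finset.prod_congr rfl fun j _ => h (x j)

theorem neg_one_pow_mul_self (n : ℕ) : (-1 : ℂ) ^ n * (-1) ^ n = 1 := by
  rw [← mul_pow]; simp

theorem card_Iic_pnat (k : ℕ+) : (Finset.Iic k).card = k := by
  rw [show Finset.Iic k = Finset.Icc 1 k from by ext j; simp, PNat.card_Icc]
  simp

/-- Source of the sign `(-1)^k`: `check` flips the `k` coordinates that enter the phase. -/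
theorem conj_phase'_check (k : ℕ+) (x : X) :
    (starRingEnd ℂ) (phase' k (check x)) * (-1) ^ (k : ℕ) = phase' k x := by
  rw [phase', sign_check, card_Iic_pnat, phase']
  simp only [map_mul, map_pow, map_neg, map_one]
  rw [mul_right_comm, neg_one_pow_mul_self, one_mul]

/-- Only `k - 1` coordinates are flipped here; the missing sign comes from conjugating `-i`. -/
theorem conj_phase_check (k : ℕ+) (x : X) :
    (starRingEnd ℂ) (phase k (check x)) * (-1) ^ (k : ℕ) = phase k x := by
  have hc : (k : ℕ) = (Finset.Iio k).card + 1 := by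
    rw [Finset.card_Iio_eq_card_Iic_sub_one, card_Iic_pnat]
    exact (Nat.sub_add_cancel k.pos).symm
  rw [phase, sign_check, phase]
  simp only [map_mul, map_pow, map_neg, map_one, Complex.conj_I]
  rw [hc, pow_succ]
  linear_combination (-Complex.I * (-1) ^ (∑ j ∈ Finset.Iio k, (x j).val)) *
    neg_one_pow_mul_self (Finset.Iio k).card

/-! ### Almost-everywhere calculus for the weights and sections of a triple. -/

namespace Triple

variable {K : Type u} [NormedAddCommGroup K] [InnerProductSpace ℂ K] [CompleteSpace K]

theorem ae_add_delta (T : Triple K) (k : ℕ+) {p : X → Prop} (h : ∀ᵐ x ∂T.μ, p x) :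
    ∀ᵐ x ∂T.μ, p (x + delta k) := (T.quasiMeasurePreserving k).ae h

theorem ae_check (T : Triple K) (hac : checkMeasure T.μ ≪ T.μ) {p : X → Prop}
    (h : ∀ᵐ x ∂T.μ, p x) : ∀ᵐ x ∂T.μ, p (check x) :=
  (Measure.QuasiMeasurePreserving.mk measurable_check hac).ae h

/-- The square root of `dμ(x + δᵏ) / dμ(x)`. -/
def deltaWeight (T : Triple K) (k : ℕ+) (x : X) : ℝ := weight T.μ (fun x => x + delta k) x

theorem shift_apply (T : Triple K) (ε : X → ℂ) (k : ℕ+) (f : X → K) (x : X) :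
    T.shift ε k f x = ε x • T.c k x ((T.deltaWeight k x : ℂ) • f (x + delta k)) := rfl

theorem shift_congr (T : Triple K) (ε : X → ℂ) (k : ℕ+) {f g : X → K} (h : f =ᵐ[T.μ] g) :
    T.shift ε k f =ᵐ[T.μ] T.shift ε k g := by
  filter_upwards [T.ae_add_delta k h] with x hx
  rw [shift_apply, shift_apply, hx]

theorem deltaWeight_mul (T : Triple K) (k : ℕ+) :
    ∀ᵐ x ∂T.μ, T.deltaWeight k x * T.deltaWeight k (x + delta k) = 1 :=
  weight_mul_weight_apply (measurable_add_right' _) (add_delta_involutive k)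
    (T.quasiInvariant _ (delta_mem k)).1

/-- The square root of `dμ̌ / dμ`. -/
def checkWeight (T : Triple K) (x : X) : ℝ := weight T.μ check x

theorem checkWeight_mul (T : Triple K) (hac : checkMeasure T.μ ≪ T.μ) :
    ∀ᵐ x ∂T.μ, T.checkWeight x * T.checkWeight (check x) = 1 :=
  weight_mul_weight_apply measurable_check check_involutive hac

/-- Both sides are the weight of the composite of `check` and translation by `δᵏ`, which commute. -/
theorem checkWeight_mul_deltaWeight (T : Triple K) (hac : checkMeasure T.μ ≪ T.μ) (k : ℕ+) :
    ∀ᵐ x ∂T.μ, T.checkWeight x * T.deltaWeight k (check x)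
      = T.deltaWeight k x * T.checkWeight (x + delta k) := by
  have hδ := (T.quasiInvariant _ (delta_mem k)).1
  filter_upwards [weight_comp measurable_check check_involutive hac
      (measurable_add_right' (delta k)) (add_delta_involutive k) hδ,
    weight_comp (measurable_add_right' (delta k)) (add_delta_involutive k) hδ
      measurable_check check_involutive hac] with x h1 h2
  have h : check ∘ (fun x => x + delta k) = (fun x => x + delta k) ∘ check :=
    funext fun x => check_add_delta x k
  rw [h] at h1
  exact h1.symm.trans h2

theorem checkWeight_ne_zero (T : Triple K) (hac : checkMeasure T.μ ≪ T.μ) :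
    ∀ᵐ x ∂T.μ, (T.checkWeight x : ℂ) ≠ 0 := by
  filter_upwards [T.checkWeight_mul hac] with x hx
  exact Complex.ofReal_ne_zero.2 (left_ne_zero_of_mul (hx.trans_ne one_ne_zero))

theorem deltaWeight_ne_zero (T : Triple K) (k : ℕ+) :
    ∀ᵐ x ∂T.μ, (T.deltaWeight k x : ℂ) ≠ 0 := by
  filter_upwards [T.deltaWeight_mul k] with x hx
  exact Complex.ofReal_ne_zero.2 (left_ne_zero_of_mul (hx.trans_ne one_ne_zero))

theorem norm_checkWeight_smul (T : Triple K) (x : X) (v : K) :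
    ‖(T.checkWeight x : ℂ) • v‖ = T.checkWeight x * ‖v‖ := by
  rw [norm_smul, Complex.norm_real,
    Real.norm_of_nonneg (show 0 ≤ T.checkWeight x from weight_nonneg _ _ _)]

theorem J_ae [SecondCountableTopology K] (T : Triple K) (k : ℕ+) (f : T.Space) :
    (T.J k f : Lp K 2 T.μ) =ᵐ[T.μ] T.shift (phase k) k (f : Lp K 2 T.μ) :=
  (T.shift_memLp (measurable_phase k) (norm_phase k) k f).coeFn_toLp

theorem J'_ae [SecondCountableTopology K] (T : Triple K) (k : ℕ+) (f : T.Space) :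
    (T.J' k f : Lp K 2 T.μ) =ᵐ[T.μ] T.shift (phase' k) k (f : Lp K 2 T.μ) :=
  (T.shift_memLp (measurable_phase' k) (norm_phase' k) k f).coeFn_toLp

theorem mem_V (T : Triple K) (f : T.Space) : ∀ᵐ x ∂T.μ, (f : Lp K 2 T.μ) x ∈ T.V x := f.2

theorem Space.ext (T : Triple K) {f g : T.Space}
    (h : (f : Lp K 2 T.μ) =ᵐ[T.μ] (g : Lp K 2 T.μ)) : f = g :=
  Subtype.ext (Lp.ext h)

theorem norm_starProjection_le (S : ClosedSubmodule ℂ K) (v : K) :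
    ‖S.toSubmodule.starProjection v‖ ≤ ‖v‖ :=
  Submodule.norm_starProjection_apply_le _ v

/-- The section `x ↦ q(x) (√(dμ̌/dμ) f(x̌))`. -/
def transport (T : Triple K) (q : X → K →L⋆[ℂ] K) (f : X → K) (x : X) : K :=
  q x ((T.checkWeight x : ℂ) • f (check x))

theorem transport_congr (T : Triple K) (hac : checkMeasure T.μ ≪ T.μ) (q : X → K →L⋆[ℂ] K)
    {f g : X → K} (h : f =ᵐ[T.μ] g) : T.transport q f =ᵐ[T.μ] T.transport q g := by
  filter_upwards [T.ae_check hac h] with x hx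
  rw [transport, transport, hx]

variable {T : Triple K} {q : X → K →L⋆[ℂ] K}

/-! ### From a quaternionic field to an operator on the direct integral. -/

namespace IsQuaternionicField

theorem norm_transport (hq : T.IsQuaternionicField q) (hac : checkMeasure T.μ ≪ T.μ)
    {f : X → K} (hf : ∀ᵐ x ∂T.μ, f x ∈ T.V x) :
    ∀ᵐ x ∂T.μ, ‖T.transport q f x‖ = T.checkWeight x * ‖f (check x)‖ := by
  filter_upwards [T.ae_check hac hf, hq.norm_map] with x h1 h2
  rw [transport, h2 _ ((T.V (check x)).toSubmodule.smul_mem _ h1), norm_checkWeight_smul]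

theorem aestronglyMeasurable_transport [SecondCountableTopology K] (hq : T.IsQuaternionicField q)
    (hac : checkMeasure T.μ ≪ T.μ) {f : X → K} (hfm : StronglyMeasurable f)
    (hf : ∀ᵐ x ∂T.μ, f x ∈ T.V x) : AEStronglyMeasurable (T.transport q f) T.μ := by
  borelize K
  have hu : StronglyMeasurable (Function.uncurry fun (v : K) (x : X) =>
      q x ((T.V (check x)).toSubmodule.starProjection v)) :=
    stronglyMeasurable_uncurry_of_continuous_of_stronglyMeasurable
      (fun x => (q x).continuous.comp
        (T.V (check x)).toSubmodule.starProjection.continuous) hq.measurable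
  have hs : StronglyMeasurable fun x => (T.checkWeight x : ℂ) • f (check x) :=
    (Complex.measurable_ofReal.comp (measurable_weight _ _)).stronglyMeasurable.smul
      (hfm.comp_measurable measurable_check)
  refine ⟨_, hu.comp_measurable (hs.measurable.prodMk measurable_id), ?_⟩
  filter_upwards [T.ae_check hac hf] with x hx
  change _ = q x ((T.V (check x)).toSubmodule.starProjection
    ((T.checkWeight x : ℂ) • f (check x)))
  rw [Submodule.starProjection_eq_self_iff.2 ((T.V (check x)).toSubmodule.smul_mem _ hx)]
  rfl

theorem eLpNorm_transport (hq : T.IsQuaternionicField q) (hac : checkMeasure T.μ ≪ T.μ)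
    {f : X → K} (hfm : StronglyMeasurable f) (hf : ∀ᵐ x ∂T.μ, f x ∈ T.V x) :
    eLpNorm (T.transport q f) 2 T.μ = eLpNorm f 2 T.μ :=
  eLpNorm_two_eq_of_norm_eq_weight_mul measurable_check check_involutive hac hfm
    (hq.norm_transport hac hf)

theorem memLp_transport [SecondCountableTopology K] (hq : T.IsQuaternionicField q)
    (hac : checkMeasure T.μ ≪ T.μ) (f : T.Space) :
    MemLp (T.transport q (f : Lp K 2 T.μ)) 2 T.μ :=
  ⟨hq.aestronglyMeasurable_transport hac (Lp.stronglyMeasurable _) f.2, by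
    rw [hq.eLpNorm_transport hac (Lp.stronglyMeasurable _) f.2]
    exact (Lp.memLp (f : Lp K 2 T.μ)).2⟩

theorem transport_mem (hq : T.IsQuaternionicField q) (hac : checkMeasure T.μ ≪ T.μ)
    {f : X → K} (hf : ∀ᵐ x ∂T.μ, f x ∈ T.V x) : ∀ᵐ x ∂T.μ, T.transport q f x ∈ T.V x := by
  filter_upwards [T.ae_check hac hf, hq.mapsTo] with x h1 h2
  exact h2 _ ((T.V (check x)).toSubmodule.smul_mem _ h1)

theorem transport_transport (hq : T.IsQuaternionicField q) (hac : checkMeasure T.μ ≪ T.μ)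
    {f : X → K} (hf : ∀ᵐ x ∂T.μ, f x ∈ T.V x) :
    ∀ᵐ x ∂T.μ, T.transport q (T.transport q f) x = -f x := by
  filter_upwards [hf, hq.mul_check, T.checkWeight_mul hac] with x h1 h2 h3
  simp only [transport, check_check, map_smulₛₗ, Complex.conj_ofReal]
  rw [h2 _ h1, smul_smul, ← Complex.ofReal_mul, h3,
    Complex.ofReal_one, one_smul]

/-- Antilinearity conjugates the phase at `x̌`, and `q` contributes `(-1)^k` on passing `c k`; `hε`
says that together they restore the phase at `x`. The weights match by the cocycle identity. Both
`phase k` and `phase' k` satisfy `hε`. -/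
theorem transport_shift (hq : T.IsQuaternionicField q) (hac : checkMeasure T.μ ≪ T.μ)
    {k : ℕ+} {ε : X → ℂ}
    (hε : ∀ x, (starRingEnd ℂ) (ε (check x)) * (-1) ^ (k : ℕ) = ε x) {f : X → K}
    (hf : ∀ᵐ x ∂T.μ, f x ∈ T.V x) :
    T.transport q (T.shift ε k f) =ᵐ[T.μ] T.shift ε k (T.transport q f) := by
  filter_upwards [T.ae_add_delta k (T.ae_check hac hf), hq.intertwine k,
    T.checkWeight_mul_deltaWeight hac k,
    T.ae_check hac (T.invariant _ (delta_mem k))] with x h1 h2 h3 h4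
  rw [check_add_delta, h4] at h1
  simp only [transport, shift_apply, map_smulₛₗ, Complex.conj_ofReal, RingHom.id_apply,
    check_add_delta, h2 _ h1, smul_smul, ← hε x, map_mul]
  congr 1
  have h5 : (T.checkWeight x : ℂ) * T.deltaWeight k (check x)
      = T.deltaWeight k x * T.checkWeight (x + delta k) := by exact_mod_cast h3
  linear_combination ((starRingEnd ℂ) (ε (check x)) * (-1) ^ (k : ℕ)) * h5

variable [SecondCountableTopology K]

/-- The operator on `V(μ, ν, 𝒞)` defined by a quaternionic field. -/
def toOperator (hq : T.IsQuaternionicField q) (hac : checkMeasure T.μ ≪ T.μ) :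
    T.Space →ₗ⋆[ℂ] T.Space where
  toFun f := ⟨(hq.memLp_transport hac f).toLp _, by
    change ∀ᵐ x ∂T.μ, _
    filter_upwards [(hq.memLp_transport hac f).coeFn_toLp, hq.transport_mem hac f.2] with x h1 h2
    rwa [h1]⟩
  map_add' f g := by
    refine Space.ext T ?_
    refine (hq.memLp_transport hac (f + g)).coeFn_toLp.trans ?_
    refine (T.transport_congr hac q (Lp.coeFn_add _ _)).trans ?_
    refine Filter.EventuallyEq.trans ?_ (Lp.coeFn_add _ _).symm
    filter_upwards [(hq.memLp_transport hac f).coeFn_toLp,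
      (hq.memLp_transport hac g).coeFn_toLp] with x h1 h2
    rw [Pi.add_apply, h1, h2]
    simp [transport]
  map_smul' z f := by
    refine Space.ext T ?_
    refine (hq.memLp_transport hac (z • f)).coeFn_toLp.trans ?_
    refine (T.transport_congr hac q (Lp.coeFn_smul _ _)).trans ?_
    refine Filter.EventuallyEq.trans ?_ (Lp.coeFn_smul _ _).symm
    filter_upwards [(hq.memLp_transport hac f).coeFn_toLp] with x h1
    rw [Pi.smul_apply, h1]
    rw [transport, transport, Pi.smul_apply, smul_comm, map_smulₛₗ]

theorem toOperator_ae (hq : T.IsQuaternionicField q) (hac : checkMeasure T.μ ≪ T.μ)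
    (f : T.Space) : (hq.toOperator hac f : Lp K 2 T.μ) =ᵐ[T.μ] T.transport q (f : Lp K 2 T.μ) :=
  (hq.memLp_transport hac f).coeFn_toLp

theorem isInvariantQuaternionicStructure (hq : T.IsQuaternionicField q)
    (hac : checkMeasure T.μ ≪ T.μ) : T.IsInvariantQuaternionicStructure (hq.toOperator hac) where
  norm_map f := by
    change ‖(hq.memLp_transport hac f).toLp _‖ = ‖(f : Lp K 2 T.μ)‖
    rw [Lp.norm_toLp, hq.eLpNorm_transport hac (Lp.stronglyMeasurable _) f.2, Lp.norm_def]
  sq f := by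
    refine Space.ext T ?_
    refine (hq.toOperator_ae hac _).trans ?_
    refine (T.transport_congr hac q (hq.toOperator_ae hac f)).trans ?_
    exact Filter.EventuallyEq.trans (hq.transport_transport hac f.2) (Lp.coeFn_neg _).symm
  comm k f := by
    refine Space.ext T ?_
    refine (hq.toOperator_ae hac _).trans ?_
    refine (T.transport_congr hac q (T.J_ae k f)).trans ?_
    refine (hq.transport_shift hac (conj_phase_check k) f.2).trans ?_
    refine (T.shift_congr _ k (hq.toOperator_ae hac f).symm).trans ?_
    exact (T.J_ae k _).symm
  comm' k f := by
    refine Space.ext T ?_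
    refine (hq.toOperator_ae hac _).trans ?_
    refine (T.transport_congr hac q (T.J'_ae k f)).trans ?_
    refine (hq.transport_shift hac (conj_phase'_check k) f.2).trans ?_
    refine (T.shift_congr _ k (hq.toOperator_ae hac f).symm).trans ?_
    exact (T.J'_ae k _).symm

end IsQuaternionicField

end Triple

/-! ### The products `J_k J'_k` as multiplication operators, and restriction of sections. -/

theorem phase_mul_phase'_add_delta (k : ℕ+) (x : X) :
    phase k x * phase' k (x + delta k) = Complex.I * (if x k = 0 then 1 else -1) := by
  have h1 : Finset.Iic k = insert k (Finset.Iio k) := (Finset.Iio_insert k).symm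
  have h2 : ∑ j ∈ Finset.Iio k, ((x + delta k) j).val = ∑ j ∈ Finset.Iio k, (x j).val := by
    refine Finset.sum_congr rfl fun j hj => ?_
    simp [delta, Pi.single_eq_of_ne (Finset.mem_Iio.1 hj).ne]
  have h3 : ∀ a : ZMod 2, (a = 0 ∧ (a + 1).val = 1) ∨ (a ≠ 0 ∧ (a + 1).val = 0) := by decide
  rw [phase, phase', h1, Finset.sum_insert (by simp), h2, pow_add]
  have h4 : (x + delta k) k = x k + 1 := by simp [delta]
  rw [h4]
  have h5 := neg_one_pow_mul_self (∑ j ∈ Finset.Iio k, (x j).val)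
  rcases h3 (x k) with ⟨ha, hb⟩ | ⟨ha, hb⟩ <;> rw [hb] <;> simp only [ha, if_true, if_false]
  · linear_combination Complex.I * h5
  · linear_combination -Complex.I * h5

section Density

theorem map_mem_of_dense {K : Type*} [NormedAddCommGroup K] [InnerProductSpace ℂ K]
    (S : ClosedSubmodule ℂ K) {ι : Type*} {s : ι → K}
    (hs : DenseRange s) {g : K → K} (hg : Continuous g) (h : ∀ i, g (s i) ∈ S) (v : K) :
    g v ∈ S :=
  hs.induction_on (p := fun w => g w ∈ S) v (S.isClosed.preimage hg) h

variable {K : Type*} [NormedAddCommGroup K] [InnerProductSpace ℂ K] [CompleteSpace K]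

/-- Projections of a dense family are dense in `S`. This lets countably many almost-everywhere
identities yield one null set outside which an identity holds on the whole fibre. -/
theorem eqOn_of_eq_starProjection (S : ClosedSubmodule ℂ K) {ι : Type*} {s : ι → K}
    (hs : DenseRange s) {g₁ g₂ : K → K} (h₁ : Continuous g₁) (h₂ : Continuous g₂)
    (h : ∀ i, g₁ (S.toSubmodule.starProjection (s i)) = g₂ (S.toSubmodule.starProjection (s i)))
    {v : K} (hv : v ∈ S) : g₁ v = g₂ v := by
  have hP : ∀ w : K, g₁ (S.toSubmodule.starProjection w) = g₂ (S.toSubmodule.starProjection w) := by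
    intro w
    refine hs.induction_on (p := fun w => g₁ (S.toSubmodule.starProjection w)
      = g₂ (S.toSubmodule.starProjection w)) w (isClosed_eq ?_ ?_) h
    · exact h₁.comp (ContinuousLinearMap.continuous _)
    · exact h₂.comp (ContinuousLinearMap.continuous _)
  simpa only [Submodule.starProjection_eq_self_iff.2 hv] using hP v

end Density

namespace Triple

variable {K : Type u} [NormedAddCommGroup K] [InnerProductSpace ℂ K] [CompleteSpace K]

/-- With `c* = c k (x + δᵏ)`, expand `‖c c* v - v‖²`: the cross term is `‖c* v‖² = ‖v‖²` by
adjointness, so everything cancels. -/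
theorem c_apply_c_add_delta (T : Triple K) (k : ℕ+) :
    ∀ᵐ x ∂T.μ, ∀ v ∈ T.V x, T.c k x (T.c k (x + delta k) v) = v := by
  filter_upwards [T.isometric k, T.ae_add_delta k (T.isometric k), T.adjoint k,
    T.ae_add_delta k (T.onto k), T.invariant _ (delta_mem k)] with x h1 h2 h3 h4 h5 v hv
  rw [h5] at h2 h4
  have hw : T.c k (x + delta k) v ∈ T.V x := by
    have : T.c k (x + delta k) v ∈ (T.V x).toSubmodule.map (T.c k (x + delta k) : K →ₗ[ℂ] K) :=
      Submodule.mem_map_of_mem hv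
    rwa [h4] at this
  have h6 := norm_sub_sq (𝕜 := ℂ) (T.c k x (T.c k (x + delta k) v)) v
  rw [h3 _ hw v hv, h1 _ hw, inner_self_eq_norm_sq, h2 v hv] at h6
  have h7 : ‖T.c k x (T.c k (x + delta k) v) - v‖ ^ 2 = 0 := by rw [h6]; ring
  exact sub_eq_zero.1 (norm_eq_zero.1 (pow_eq_zero_iff two_ne_zero |>.1 h7))

/-- The restriction `1_A f` of a section to a measurable set. -/
def restrict (T : Triple K) {A : Set X} (hA : MeasurableSet A) (f : T.Space) : T.Space :=
  ⟨((Lp.memLp (f : Lp K 2 T.μ)).indicator hA).toLp _, by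
    change ∀ᵐ x ∂T.μ, _
    filter_upwards [((Lp.memLp (f : Lp K 2 T.μ)).indicator hA).coeFn_toLp, f.2] with x h1 h2
    rw [h1]
    by_cases hx : x ∈ A
    · rwa [Set.indicator_of_mem hx]
    · rw [Set.indicator_of_notMem hx]
      exact (T.V x).toSubmodule.zero_mem⟩

theorem restrict_ae (T : Triple K) {A : Set X} (hA : MeasurableSet A) (f : T.Space) :
    (T.restrict hA f : Lp K 2 T.μ) =ᵐ[T.μ] A.indicator (f : Lp K 2 T.μ) :=
  ((Lp.memLp (f : Lp K 2 T.μ)).indicator hA).coeFn_toLp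

theorem restrict_restrict (T : Triple K) {A B : Set X} (hA : MeasurableSet A)
    (hB : MeasurableSet B) (f : T.Space) :
    T.restrict hA (T.restrict hB f) = T.restrict (hA.inter hB) f := by
  refine Space.ext T ?_
  filter_upwards [T.restrict_ae hA (T.restrict hB f), T.restrict_ae hB f,
    T.restrict_ae (hA.inter hB) f] with x h1 h2 h3
  rw [h1, h3, ← Set.indicator_indicator]
  by_cases hx : x ∈ A <;> simp [hx, h2]

theorem restrict_compl (T : Triple K) {A B : Set X} (hA : MeasurableSet A)
    (hB : MeasurableSet B) (hAB : ∀ x, x ∈ B ↔ x ∉ A) (f : T.Space) :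
    T.restrict hB f = f - T.restrict hA f := by
  refine Space.ext T ?_
  filter_upwards [T.restrict_ae hA f, T.restrict_ae hB f,
    Lp.coeFn_sub (f : Lp K 2 T.μ) (T.restrict hA f : Lp K 2 T.μ)] with x h1 h2 h3
  rw [h2, Submodule.coe_sub, h3, Pi.sub_apply, h1]
  by_cases hx : x ∈ A <;> simp [hx, hAB]

theorem measurableSet_coord (k : ℕ+) (a : ZMod 2) : MeasurableSet {x : X | x k = a} :=
  (measurable_pi_apply (X := fun _ : ℕ+ => ZMod 2) k) (MeasurableSet.singleton a)

theorem measurableSet_check_preimage {A : Set X} (hA : MeasurableSet A) :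
    MeasurableSet (check ⁻¹' A) :=
  measurable_check hA

theorem lintegral_restrict (T : Triple K) {A : Set X} (hA : MeasurableSet A) (f : T.Space) :
    ∫⁻ x, ‖(T.restrict hA f : Lp K 2 T.μ) x‖ₑ ^ 2 ∂T.μ
      = ∫⁻ x in A, ‖(f : Lp K 2 T.μ) x‖ₑ ^ 2 ∂T.μ := by
  rw [← lintegral_indicator hA]
  refine lintegral_congr_ae ?_
  filter_upwards [T.restrict_ae hA f] with x hx
  rw [hx]
  by_cases h : x ∈ A <;> simp [h]

theorem lintegral_enorm_sq (T : Triple K) (f : T.Space) :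
    ∫⁻ x, ‖(f : Lp K 2 T.μ) x‖ₑ ^ 2 ∂T.μ = ENNReal.ofReal ‖f‖ ^ 2 := by
  have h : ENNReal.ofReal ‖f‖ = eLpNorm (f : Lp K 2 T.μ) 2 T.μ := by
    rw [Submodule.coe_norm, Lp.norm_def, ENNReal.ofReal_toReal (Lp.eLpNorm_ne_top _)]
  have := eLpNorm_nnreal_pow_eq_lintegral (μ := T.μ) (f := ((f : Lp K 2 T.μ) : X → K))
    (p := 2) two_ne_zero
  rw [h]
  simpa using this.symm

variable [SecondCountableTopology K]

/-- The two shifts by `δᵏ` cancel, as do the weights and the unitaries, leaving the product of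
phases `i (-1)^(x_k)`, written as `i (2 · 1_{x_k = 0} - 1)`. -/
theorem J_J' (T : Triple K) (k : ℕ+) (f : T.Space) :
    T.J k (T.J' k f)
      = Complex.I • ((2 : ℂ) • T.restrict (measurableSet_coord k 0) f - f) := by
  refine Space.ext T ?_
  refine (T.J_ae k _).trans ((T.shift_congr _ k (T.J'_ae k f)).trans ?_)
  filter_upwards [T.restrict_ae (measurableSet_coord k 0) f, T.c_apply_c_add_delta k,
    T.deltaWeight_mul k, f.2,
    Lp.coeFn_smul Complex.I ((2 : ℂ) • ((T.restrict (measurableSet_coord k 0) f : T.Space) : Lp K 2 T.μ) - (f : Lp K 2 T.μ)),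
    Lp.coeFn_sub ((2 : ℂ) • (T.restrict (measurableSet_coord k 0) f : Lp K 2 T.μ))
      (f : Lp K 2 T.μ),
    Lp.coeFn_smul (2 : ℂ) (T.restrict (measurableSet_coord k 0) f : Lp K 2 T.μ)]
    with x h1 h2 h3 h4 h5 h6 h7
  rw [Submodule.coe_smul, Submodule.coe_sub, Submodule.coe_smul, h5, Pi.smul_apply, h6,
    Pi.sub_apply, h7, Pi.smul_apply, h1]
  have h3' : (T.deltaWeight k x : ℂ) * T.deltaWeight k (x + delta k) = 1 := by exact_mod_cast h3
  simp only [shift_apply, add_delta_add_delta, map_smul, smul_smul, h2 _ h4]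
  have e : phase k x * (T.deltaWeight k x : ℂ) * phase' k (x + delta k)
      * (T.deltaWeight k (x + delta k) : ℂ) = Complex.I * (if x k = 0 then 1 else -1) := by
    rw [← phase_mul_phase'_add_delta]
    linear_combination (phase k x * phase' k (x + delta k)) * h3'
  have e2 : ∀ z : ℂ, z = Complex.I * (if x k = 0 then 1 else -1) →
      z • (f : Lp K 2 T.μ) x = Complex.I • ((2 : ℂ) •
        ({x : X | x k = 0}.indicator (f : Lp K 2 T.μ) x) - (f : Lp K 2 T.μ) x) := by
    rintro z rfl
    by_cases hx : x k = 0
    · simp [hx, two_smul]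
    · simp [hx]
  refine e2 _ ?_
  rw [← e]
  ring

/-! ### How `Q` moves supports and measures. -/

namespace IsInvariantQuaternionicStructure

variable {T : Triple K} {Q : T.Space →ₗ⋆[ℂ] T.Space}

/-- If `E` is restriction to `x_k = 0`, then `Q` commutes with `i (2E - 1)` and anticommutes with
`i`, so `Q (2E - 1) = -(2E - 1) Q`, that is `Q E = (1 - E) Q`. -/
theorem map_restrict_coord_zero (hQ : T.IsInvariantQuaternionicStructure Q) (k : ℕ+)
    (f : T.Space) : Q (T.restrict (measurableSet_coord k 0) f)
      = Q f - T.restrict (measurableSet_coord k 0) (Q f) := by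
  have h : Q (T.J k (T.J' k f)) = T.J k (T.J' k (Q f)) := by rw [hQ.comm, hQ.comm']
  have hc : (starRingEnd ℂ) 2 = 2 := map_ofNat _ 2
  rw [J_J', J_J', map_smulₛₗ, map_sub, map_smulₛₗ, Complex.conj_I, neg_smul, ← smul_neg, hc] at h
  have h2 := smul_right_injective T.Space Complex.I_ne_zero h
  have h3 : (2 : ℂ) • Q (T.restrict (measurableSet_coord k 0) f)
      = (2 : ℂ) • (Q f - T.restrict (measurableSet_coord k 0) (Q f)) := by
    rw [smul_sub, two_smul ℂ (Q f), ← sub_eq_zero]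
    have h4 := sub_eq_zero.2 h2
    rw [← neg_eq_zero, ← h4]
    abel
  exact smul_right_injective T.Space (two_ne_zero (α := ℂ)) h3

theorem map_restrict_coord (hQ : T.IsInvariantQuaternionicStructure Q) (k : ℕ+) (a : ZMod 2)
    (f : T.Space) : Q (T.restrict (measurableSet_coord k a) f)
      = T.restrict (measurableSet_check_preimage (measurableSet_coord k a)) (Q f) := by
  have hz : ∀ b : ZMod 2, (b + 1 = 0 ↔ b ≠ 0) ∧ (b + 1 = 1 ↔ b = 0) ∧ (b = 1 ↔ b ≠ 0) := by
    decide
  have ha : ∀ a : ZMod 2, a = 0 ∨ a = 1 := by decide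
  rcases ha a with rfl | rfl
  · rw [hQ.map_restrict_coord_zero]
    exact (T.restrict_compl _ _ (fun x => (hz (x k)).1) _).symm
  · rw [T.restrict_compl (measurableSet_coord k 0) _ (fun x => (hz (x k)).2.2), map_sub,
      hQ.map_restrict_coord_zero, sub_sub_cancel]
    refine Space.ext T ?_
    filter_upwards [T.restrict_ae (measurableSet_coord k 0) (Q f),
      T.restrict_ae (measurableSet_check_preimage (measurableSet_coord k 1)) (Q f)] with x h1 h2
    rw [h1, h2]
    congr 1
    ext y
    exact (hz (y k)).2.1.symm

theorem measure_eq (hQ : T.IsInvariantQuaternionicStructure Q) (f : T.Space) :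
    (T.μ.withDensity fun x => ‖(Q f : Lp K 2 T.μ) x‖ₑ ^ 2).map check
      = T.μ.withDensity fun x => ‖(f : Lp K 2 T.μ) x‖ₑ ^ 2 := by
  -- The sets whose restriction `Q` carries to restriction to the flipped set. They form a π-system
  -- containing the coordinate cylinders, and on them the two finite measures agree because `Q`
  -- preserves norms.
  let C : Set (Set X) := {A | ∃ hA : MeasurableSet A, ∀ f : T.Space,
    Q (T.restrict hA f) = T.restrict (measurableSet_check_preimage hA) (Q f)}
  have hfin : IsFiniteMeasure (T.μ.withDensity fun x => ‖(Q f : Lp K 2 T.μ) x‖ₑ ^ 2) :=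
    isFiniteMeasure_withDensity (by
      rw [lintegral_enorm_sq]
      exact ENNReal.pow_ne_top ENNReal.ofReal_ne_top)
  have hC : ∀ A ∈ C, (T.μ.withDensity fun x => ‖(Q f : Lp K 2 T.μ) x‖ₑ ^ 2).map check A
      = (T.μ.withDensity fun x => ‖(f : Lp K 2 T.μ) x‖ₑ ^ 2) A := by
    rintro A ⟨hA, h⟩
    rw [Measure.map_apply measurable_check hA, withDensity_apply _ (measurableSet_check_preimage hA),
      withDensity_apply _ hA, ← lintegral_restrict T (measurableSet_check_preimage hA),
      ← lintegral_restrict T hA, lintegral_enorm_sq,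
      lintegral_enorm_sq, ← h, hQ.norm_map]
  refine ext_of_generate_finite C ?_ ?_ hC ?_
  · refine le_antisymm ?_ (MeasurableSpace.generateFrom_le fun A hA => hA.1)
    refine iSup_le fun k => Measurable.comap_le ?_
    refine @measurable_to_countable' _ _ _ _ (MeasurableSpace.generateFrom C) _ fun a => ?_
    exact MeasurableSpace.measurableSet_generateFrom
      ⟨measurableSet_coord k a, fun g => hQ.map_restrict_coord k a g⟩
  · rintro A ⟨hA, h1⟩ B ⟨hB, h2⟩ -
    refine ⟨hA.inter hB, fun g => ?_⟩
    rw [← T.restrict_restrict hA hB, h1, h2, restrict_restrict]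
    rfl
  · refine hC _ ⟨MeasurableSet.univ, fun g => ?_⟩
    have h : ∀ (A : Set X) (hA : MeasurableSet A), A = Set.univ →
        ∀ g : T.Space, T.restrict hA g = g := by
      rintro A hA rfl g
      refine Space.ext T ?_
      filter_upwards [T.restrict_ae hA g] with x hx
      rw [hx, Set.indicator_univ]
    exact (congrArg Q (h _ _ rfl g)).trans (h _ _ rfl (Q g)).symm

theorem setLIntegral_eq (hQ : T.IsInvariantQuaternionicStructure Q) (f : T.Space) {A : Set X}
    (hA : MeasurableSet A) :
    ∫⁻ x in check ⁻¹' A, ‖(Q f : Lp K 2 T.μ) x‖ₑ ^ 2 ∂T.μ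
      = ∫⁻ x in A, ‖(f : Lp K 2 T.μ) x‖ₑ ^ 2 ∂T.μ := by
  rw [← withDensity_apply _ (measurableSet_check_preimage hA), ← withDensity_apply _ hA, ← hQ.measure_eq f,
    Measure.map_apply measurable_check hA]

end IsInvariantQuaternionicStructure

end Triple

/-! ### Fibrewise decomposition of `Q`. -/

namespace Triple

variable {K : Type u} [NormedAddCommGroup K] [InnerProductSpace ℂ K] [CompleteSpace K]
  [SecondCountableTopology K]

/-- The fibres are spanned by the values of countably many square-integrable sections. -/
theorem exists_total_sections (T : Triple K) : ∃ (h : X → ℝ) (f : ℕ → T.Space),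
    Measurable h ∧ (∀ x, 0 < h x) ∧ ∀ i, (f i : Lp K 2 T.μ) =ᵐ[T.μ] fun x =>
      (h x : ℂ) • (T.V x).toSubmodule.starProjection (TopologicalSpace.denseSeq K i) := by
  -- A strictly positive integrable function exists by σ-finiteness; its square root makes bounded
  -- sections square-integrable without losing any fibre.
  obtain ⟨g, hg, hgm, hgi⟩ := exists_pos_lintegral_lt_of_sigmaFinite T.μ one_ne_zero
  have hm : Measurable fun x => √(g x : ℝ) := hgm.coe_nnreal_real.sqrt
  have hL : ∀ v : K, MemLp (fun x => ((√(g x : ℝ) : ℝ) : ℂ) •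
      (T.V x).toSubmodule.starProjection v) 2 T.μ := by
    intro v
    refine ⟨((Complex.measurable_ofReal.comp hm).stronglyMeasurable.smul
      (T.measurable_V v)).aestronglyMeasurable, ?_⟩
    rw [eLpNorm_lt_top_iff_lintegral_rpow_enorm_lt_top two_ne_zero ENNReal.ofNat_ne_top]
    refine lt_of_le_of_lt (lintegral_mono (g := fun x => ‖v‖ₑ ^ 2 * (g x : ℝ≥0∞))
      fun x => ?_) ?_
    · have h1 : ‖((√(g x : ℝ) : ℝ) : ℂ)‖ₑ ^ 2 = (g x : ℝ≥0∞) := by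
        rw [← ofReal_norm, Complex.norm_real, Real.norm_of_nonneg (Real.sqrt_nonneg _),
          ← ENNReal.ofReal_pow (Real.sqrt_nonneg _), Real.sq_sqrt (NNReal.coe_nonneg _),
          ENNReal.ofReal_coe_nnreal]
      have h2 : ‖(T.V x).toSubmodule.starProjection v‖ₑ ≤ ‖v‖ₑ := by
        rw [← ofReal_norm, ← ofReal_norm]
        exact ENNReal.ofReal_le_ofReal (norm_starProjection_le _ _)
      rw [ENNReal.toReal_ofNat, ENNReal.rpow_ofNat, enorm_smul, mul_pow, h1, mul_comm]
      exact mul_le_mul' (pow_le_pow_left' h2 2) le_rfl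
    · rw [lintegral_const_mul _ hgm.coe_nnreal_ennreal]
      exact ENNReal.mul_lt_top (ENNReal.pow_lt_top enorm_lt_top)
        (hgi.trans ENNReal.one_lt_top)
  refine ⟨fun x => √(g x : ℝ), fun i => ⟨(hL (TopologicalSpace.denseSeq K i)).toLp _, ?_⟩, hm,
    fun x => Real.sqrt_pos.2 (hg x), fun i => (hL _).coeFn_toLp⟩
  change ∀ᵐ x ∂T.μ, _
  filter_upwards [(hL (TopologicalSpace.denseSeq K i)).coeFn_toLp] with x hx
  rw [hx]
  exact (T.V x).toSubmodule.smul_mem _ (Submodule.starProjection_apply_mem _ _)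

namespace IsInvariantQuaternionicStructure

variable {T : Triple K} {Q : T.Space →ₗ⋆[ℂ] T.Space}

theorem measure_check_preimage_eq_zero (hQ : T.IsInvariantQuaternionicStructure Q) {A : Set X}
    (hA : MeasurableSet A) (h0 : T.μ A = 0) : T.μ (check ⁻¹' A) = 0 := by
  obtain ⟨h, f, -, hpos, hf⟩ := T.exists_total_sections
  have key : ∀ i, ∀ᵐ x ∂T.μ, x ∈ check ⁻¹' A → (f i : Lp K 2 T.μ) x = 0 := by
    intro i
    -- Since `Q (-Q f) = f`, this bounds `f i` itself on the flipped set: every spanning section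
    -- vanishes there, contradicting nonzero fibres unless that set is null.
    have h1 := hQ.setLIntegral_eq (-Q (f i)) hA
    rw [map_neg, hQ.sq, neg_neg, setLIntegral_measure_zero _ _ h0,
      lintegral_eq_zero_iff ((Lp.stronglyMeasurable _).enorm.pow_const 2),
      Filter.EventuallyEq, ae_restrict_iff' (measurableSet_check_preimage hA)] at h1
    filter_upwards [h1] with x hx hxA
    simpa using hx hxA
  rw [measure_eq_zero_iff_ae_notMem]
  filter_upwards [ae_all_iff.2 key, ae_all_iff.2 hf, T.nonzero] with x h1 h2 ⟨v, hv, hv0⟩ hxA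
  refine hv0 (eqOn_of_eq_starProjection (T.V x) (TopologicalSpace.denseRange_denseSeq K)
    continuous_id (continuous_const (y := (0 : K))) (fun i => ?_) hv)
  have h3 := h1 i hxA
  rw [h2 i, smul_eq_zero] at h3
  exact h3.resolve_left (Complex.ofReal_ne_zero.2 (hpos x).ne')

theorem measEquiv_check (hQ : T.IsInvariantQuaternionicStructure Q) :
    MeasEquiv T.μ (checkMeasure T.μ) := by
  constructor
  · refine Measure.AbsolutelyContinuous.mk fun A hA h0 => ?_
    rw [checkMeasure, Measure.map_apply measurable_check hA] at h0
    have := hQ.measure_check_preimage_eq_zero (measurableSet_check_preimage hA) h0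
    rwa [← Set.preimage_comp, check_involutive.comp_self, Set.preimage_id] at this
  · refine Measure.AbsolutelyContinuous.mk fun A hA h0 => ?_
    rw [checkMeasure, Measure.map_apply measurable_check hA]
    exact hQ.measure_check_preimage_eq_zero hA h0

/-- The integral identity over all measurable sets, after a change of variables by `check`,
identifies two densities with respect to the σ-finite `μ`. -/
theorem norm_apply (hQ : T.IsInvariantQuaternionicStructure Q) (f : T.Space) :
    ∀ᵐ x ∂T.μ, ‖(Q f : Lp K 2 T.μ) x‖ = T.checkWeight x * ‖(f : Lp K 2 T.μ) (check x)‖ := by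
  have hac := hQ.measEquiv_check.2
  have hm1 : Measurable fun x => ‖(Q f : Lp K 2 T.μ) x‖ₑ ^ 2 :=
    (Lp.stronglyMeasurable _).enorm.pow_const 2
  have hm2 : Measurable fun x => ‖(f : Lp K 2 T.μ) x‖ₑ ^ 2 :=
    (Lp.stronglyMeasurable _).enorm.pow_const 2
  have hm3 : Measurable fun x => (T.μ.map check).rnDeriv T.μ x *
      ‖(f : Lp K 2 T.μ) (check x)‖ₑ ^ 2 :=
    (Measure.measurable_rnDeriv _ _).mul (hm2.comp measurable_check)
  have h1 : T.μ.withDensity (fun x => ‖(Q f : Lp K 2 T.μ) x‖ₑ ^ 2)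
      = T.μ.withDensity fun x => (T.μ.map check).rnDeriv T.μ x *
        ‖(f : Lp K 2 T.μ) (check x)‖ₑ ^ 2 := by
    ext A hA
    have hA' := measurableSet_check_preimage hA
    have h2 := hQ.setLIntegral_eq f hA'
    rw [← Set.preimage_comp, check_involutive.comp_self, Set.preimage_id] at h2
    rw [withDensity_apply _ hA, withDensity_apply _ hA, h2, ← lintegral_indicator hA',
      ← lintegral_rnDeriv_map_mul measurable_check check_involutive hac (hm2.indicator hA'),
      ← lintegral_indicator hA]
    refine lintegral_congr fun x => ?_
    by_cases hx : x ∈ A <;> simp [Set.indicator, check_check, hx]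
  rw [withDensity_eq_iff_of_sigmaFinite hm1.aemeasurable hm3.aemeasurable] at h1
  filter_upwards [h1, ofReal_weight_sq (μ := T.μ) measurable_check check_involutive] with x h2 h3
  rw [← h3, ← mul_pow, ← ofReal_norm, ← ofReal_norm,
    ← ENNReal.ofReal_mul (weight_nonneg _ _ _)] at h2
  have h4 := (ENNReal.pow_right_strictMono two_ne_zero).injective h2
  rwa [ENNReal.ofReal_eq_ofReal_iff (norm_nonneg _)
    (mul_nonneg (weight_nonneg _ _ _) (norm_nonneg _))] at h4

/-- Apply `norm_apply` to `f + z • g` for `z = ±1, ±i` only, so that finitely many null sets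
suffice, and polarize. -/
theorem inner_apply (hQ : T.IsInvariantQuaternionicStructure Q) (f g : T.Space) :
    ∀ᵐ x ∂T.μ, inner ℂ ((Q f : Lp K 2 T.μ) x) ((Q g : Lp K 2 T.μ) x)
      = (T.checkWeight x : ℂ) ^ 2 *
        inner ℂ ((g : Lp K 2 T.μ) (check x)) ((f : Lp K 2 T.μ) (check x)) := by
  have hac := hQ.measEquiv_check.2
  have hlin : ∀ z : ℂ, ∀ᵐ x ∂T.μ,
      ‖(Q f : Lp K 2 T.μ) x + (starRingEnd ℂ z) • (Q g : Lp K 2 T.μ) x‖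
      = ‖(T.checkWeight x : ℂ) • (f : Lp K 2 T.μ) (check x)
        + z • (T.checkWeight x : ℂ) • (g : Lp K 2 T.μ) (check x)‖ := by
    intro z
    have h1 := hQ.norm_apply (f + z • g)
    rw [map_add, map_smulₛₗ] at h1
    filter_upwards [h1, Lp.coeFn_add (Q f : Lp K 2 T.μ) ((starRingEnd ℂ z) • (Q g : Lp K 2 T.μ)),
      Lp.coeFn_smul (starRingEnd ℂ z) (Q g : Lp K 2 T.μ),
      T.ae_check hac (Lp.coeFn_add (f : Lp K 2 T.μ) (z • (g : Lp K 2 T.μ))),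
      T.ae_check hac (Lp.coeFn_smul z (g : Lp K 2 T.μ))] with x h1 h2 h3 h4 h5
    rw [Submodule.coe_add, Submodule.coe_smul, h2, Pi.add_apply, h3, Pi.smul_apply,
      Submodule.coe_add, Submodule.coe_smul, h4, Pi.add_apply, h5, Pi.smul_apply] at h1
    rw [h1, smul_comm z, ← smul_add, norm_checkWeight_smul]
  filter_upwards [hlin 1, hlin (-1), hlin Complex.I, hlin (-Complex.I)] with x h1 h2 h3 h4
  simp only [map_one, map_neg, Complex.conj_I, one_smul, neg_smul, neg_neg, ← sub_eq_add_neg]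
    at h1 h2 h3 h4
  rw [inner_eq_inner_swap_of_norm_eq h1 h2 h3 h4, inner_smul_left, inner_smul_right,
    Complex.conj_ofReal]
  ring

/-- The decomposition of an invariant quaternionic structure into fibre operators. -/
theorem exists_fibre_operators (hQ : T.IsInvariantQuaternionicStructure Q) :
    ∃ q : X → K →L⋆[ℂ] K,
      (∀ v : K, StronglyMeasurable fun x =>
        q x ((T.V (check x)).toSubmodule.starProjection v)) ∧
      (∀ᵐ x ∂T.μ, ∀ v, q x v ∈ T.V x) ∧
      (∀ᵐ x ∂T.μ, ∀ v, ‖q x v‖ = ‖(T.V (check x)).toSubmodule.starProjection v‖) ∧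
      ∀ f : T.Space, (Q f : Lp K 2 T.μ) =ᵐ[T.μ] T.transport q (f : Lp K 2 T.μ) := by
  have hac := hQ.measEquiv_check.2
  obtain ⟨h, e, hhm, hpos, he⟩ := T.exists_total_sections
  set s : ℕ → K := TopologicalSpace.denseSeq K
  have hsd : DenseRange s := TopologicalSpace.denseRange_denseSeq K
  -- The desired formula for `Q (e i)` forces `Q (e i) x = a x • q x (s i)`; hence the candidate
  -- value `F i x` for `q x (s i)`.
  let a : X → ℂ := fun x => (T.checkWeight x : ℂ) * (h (check x) : ℂ)
  have ham : Measurable a := (Complex.measurable_ofReal.comp (measurable_weight _ _)).mul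
    (Complex.measurable_ofReal.comp (hhm.comp measurable_check))
  let F : ℕ → X → K := fun i x => (a x)⁻¹ • (Q (e i) : Lp K 2 T.μ) x
  have hFm : ∀ i, StronglyMeasurable (F i) := fun i =>
    ham.inv.stronglyMeasurable.smul (Lp.stronglyMeasurable _)
  let P : X → K →L[ℂ] K := fun x => (T.V (check x)).toSubmodule.starProjection
  have ha0 : ∀ᵐ x ∂T.μ, a x ≠ 0 := by
    filter_upwards [T.checkWeight_ne_zero hac] with x hx
    exact mul_ne_zero hx (Complex.ofReal_ne_zero.2 (hpos _).ne')
  have hgram : ∀ᵐ x ∂T.μ, ∀ i j,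
      inner ℂ (F i x) (F j x) = inner ℂ (P x (s j)) (P x (s i)) := by
    refine ae_all_iff.2 fun i => ae_all_iff.2 fun j => ?_
    filter_upwards [hQ.inner_apply (e i) (e j), T.ae_check hac (he i), T.ae_check hac (he j), ha0]
      with x h1 h2 h3 h4
    simp only [F, P]
    rw [inner_smul_left, inner_smul_right, h1, h2, h3, inner_smul_left, inner_smul_right,
      map_inv₀, show (starRingEnd ℂ) (a x) = a x by simp [a], Complex.conj_ofReal]
    field_simp
    simp only [a]
    ring
  obtain ⟨G, hGm, hG, hGae⟩ : ∃ G : Set X, MeasurableSet G ∧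
      (∀ x ∈ G, ∀ i j, inner ℂ (F i x) (F j x) = inner ℂ (P x (s j)) (P x (s i))) ∧
      ∀ᵐ x ∂T.μ, x ∈ G := by
    obtain ⟨N, hN, hNm, hN0⟩ := exists_measurable_superset_of_null hgram
    exact ⟨Nᶜ, hNm.compl, fun x hx => by_contra fun hc => hx (hN hc), compl_mem_ae_iff.2 hN0⟩
  -- Outside the measurable conull set `G` take the zero operator, so that `x ↦ q x (s i)` is
  -- measurable everywhere. As `L` ignores the complement of the fibre, measurability for general
  -- `v` follows by taking limits along the dense sequence.
  have hex : ∀ x, ∃ L : K →L⋆[ℂ] K, (∀ i, L (s i) = G.indicator (F i) x) ∧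
      (∀ v, L (P x v) = L v) ∧ (x ∈ G → ∀ v, ‖L v‖ = ‖P x v‖) := by
    intro x
    by_cases hx : x ∈ G
    · obtain ⟨L, h1, h2⟩ := exists_antilinear_of_gram hsd (P x)
        (fun v => norm_starProjection_le _ v) (hG x hx)
      refine ⟨L, fun i => by rw [h1, Set.indicator_of_mem hx], fun v => ?_, fun _ => h2⟩
      rw [← sub_eq_zero, ← map_sub, ← norm_eq_zero, h2, map_sub,
        Submodule.starProjection_eq_self_iff.2 (Submodule.starProjection_apply_mem _ v), sub_self,
        norm_zero]
    · exact ⟨0, fun i => by simp [hx], fun v => rfl, fun h => absurd h hx⟩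
  choose q hq1 hq2 hq3 using hex
  have hqs : ∀ᵐ x ∂T.μ, ∀ i, a x • q x (s i) = (Q (e i) : Lp K 2 T.μ) x := by
    filter_upwards [hGae, ha0] with x h1 h2 i
    rw [hq1, Set.indicator_of_mem h1, smul_inv_smul₀ h2]
  have hmem : ∀ᵐ x ∂T.μ, ∀ v, q x v ∈ T.V x := by
    filter_upwards [hqs, ha0, ae_all_iff.2 fun i => T.mem_V (Q (e i))] with x h1 h2 h3
    refine map_mem_of_dense _ hsd (q x).continuous fun i => ?_
    rw [← inv_smul_smul₀ h2 (q x (s i)), h1]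
    exact (T.V x).toSubmodule.smul_mem _ (h3 i)
  have hnorm : ∀ᵐ x ∂T.μ, ∀ v, ‖q x v‖ = ‖P x v‖ := by
    filter_upwards [hGae] with x hx using hq3 x hx
  refine ⟨q, fun v => ?_, hmem, hnorm, fun f => ?_⟩
  · change StronglyMeasurable fun x => q x (P x v)
    simp only [hq2]
    obtain ⟨u, hu, hlim⟩ := mem_closure_iff_seq_limit.1 (hsd v)
    choose i hi using hu
    refine stronglyMeasurable_of_tendsto Filter.atTop (f := fun n x => q x (u n)) (fun n => ?_)
      (tendsto_pi_nhds.2 fun x => ((q x).continuous.tendsto v).comp hlim)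
    rw [← hi n]
    simp only [hq1]
    exact (hFm _).indicator hGm
  · filter_upwards [hQ.norm_apply f, ae_all_iff.2 fun i => hQ.inner_apply f (e i), hqs, ha0,
      hnorm, T.ae_check hac f.2, ae_all_iff.2 fun i => T.ae_check hac (he i)]
      with x h1 h2 h3 h4 h5 h6 h7
    -- Pairing with the known values `q x (s i)` determines the inner product of `Q f` with its
    -- candidate. It equals both squared norms, so the difference has norm zero.
    have h8 : ∀ v, inner ℂ ((Q f : Lp K 2 T.μ) x) (q x v)
        = (T.checkWeight x : ℂ) * inner ℂ v ((f : Lp K 2 T.μ) (check x)) := by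
      intro v
      refine hsd.induction_on (p := fun v => inner ℂ ((Q f : Lp K 2 T.μ) x) (q x v)
        = (T.checkWeight x : ℂ) * inner ℂ v ((f : Lp K 2 T.μ) (check x))) v
        (isClosed_eq (by fun_prop) (by fun_prop)) fun i => ?_
      refine mul_left_cancel₀ h4 ?_
      rw [← inner_smul_right, h3, h2, h7, inner_smul_left,
        Submodule.inner_starProjection_left_eq_right,
        Submodule.starProjection_eq_self_iff.2 h6, Complex.conj_ofReal]
      simp only [a]
      ring
    have h9 : ‖T.transport q (f : Lp K 2 T.μ) x‖
        = T.checkWeight x * ‖(f : Lp K 2 T.μ) (check x)‖ := by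
      rw [transport, h5]
      simp only [P]
      rw [Submodule.starProjection_eq_self_iff.2
        ((T.V (check x)).toSubmodule.smul_mem _ h6), norm_checkWeight_smul]
    have h10 := norm_sub_sq (𝕜 := ℂ) ((Q f : Lp K 2 T.μ) x) (T.transport q (f : Lp K 2 T.μ) x)
    have h11 : inner ℂ ((Q f : Lp K 2 T.μ) x) (T.transport q (f : Lp K 2 T.μ) x)
        = ((T.checkWeight x * ‖(f : Lp K 2 T.μ) (check x)‖) ^ 2 : ℝ) := by
      rw [transport, h8, inner_smul_left, inner_self_eq_norm_sq_to_K, Complex.conj_ofReal]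
      push_cast
      simp only [Complex.coe_algebraMap]
      ring
    rw [h11, h1, h9, RCLike.re_to_complex, Complex.ofReal_re] at h10
    have h12 : ‖(Q f : Lp K 2 T.μ) x - T.transport q (f : Lp K 2 T.μ) x‖ ^ 2 = 0 := by
      rw [h10]; ring
    exact sub_eq_zero.1 (norm_eq_zero.1 (pow_eq_zero_iff two_ne_zero |>.1 h12))

/-- The relations `Q² = -1` and `Q J'_k = J'_k Q`, evaluated on the spanning sections, become the
fibre relations once nonzero scalars are cancelled. -/
theorem exists_isQuaternionicField (hQ : T.IsInvariantQuaternionicStructure Q) :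
    ∃ q : X → K →L⋆[ℂ] K, T.IsQuaternionicField q := by
  have hac := hQ.measEquiv_check.2
  obtain ⟨q, hqm, hmem, hnorm, hQq⟩ := hQ.exists_fibre_operators
  obtain ⟨h, e, -, hpos, he⟩ := T.exists_total_sections
  have hsd := TopologicalSpace.denseRange_denseSeq K
  have hh : ∀ x, (h x : ℂ) ≠ 0 := fun x => Complex.ofReal_ne_zero.2 (hpos x).ne'
  refine ⟨q, hqm, ?_, ?_, ?_, fun k => ?_⟩
  · filter_upwards [hmem] with x hx v _ using hx v
  · filter_upwards [hnorm] with x hx v hv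
    rw [hx, Submodule.starProjection_eq_self_iff.2 hv]
  · have h1 : ∀ i, ∀ᵐ x ∂T.μ, T.transport q (T.transport q (e i : Lp K 2 T.μ)) x
        = -(e i : Lp K 2 T.μ) x := by
      intro i
      have h2 := (T.transport_congr hac q (hQq (e i))).symm.trans (hQq (Q (e i))).symm
      rw [hQ.sq] at h2
      exact h2.trans (Lp.coeFn_neg _)
    filter_upwards [ae_all_iff.2 h1, T.checkWeight_mul hac, ae_all_iff.2 he] with x h1 h2 h3 v hv
    refine eqOn_of_eq_starProjection (T.V x) hsd ((q x).continuous.comp (q (check x)).continuous)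
      continuous_neg (fun i => ?_) hv
    have h4 := h1 i
    simp only [transport, check_check, map_smulₛₗ, Complex.conj_ofReal, h3] at h4
    rw [smul_smul, ← Complex.ofReal_mul, h2, Complex.ofReal_one, one_smul, ← smul_neg] at h4
    exact smul_right_injective K (hh x) h4
  · have h1 : ∀ i, T.transport q (T.shift (phase' k) k (e i : Lp K 2 T.μ))
        =ᵐ[T.μ] T.shift (phase' k) k (T.transport q (e i : Lp K 2 T.μ)) := by
      intro i
      refine (T.transport_congr hac q (T.J'_ae k (e i))).symm.trans ?_
      refine (hQq _).symm.trans ?_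
      rw [hQ.comm']
      exact (T.J'_ae k _).trans (T.shift_congr _ k (hQq (e i)))
    filter_upwards [ae_all_iff.2 h1, T.checkWeight_mul_deltaWeight hac k,
      T.checkWeight_ne_zero hac, T.ae_check hac (T.deltaWeight_ne_zero k),
      T.ae_check hac (T.invariant _ (delta_mem k)),
      T.ae_check hac (T.ae_add_delta k (ae_all_iff.2 he))] with x h1 h2 h3 h4 h5 h6 v hv
    refine eqOn_of_eq_starProjection (T.V (check x)) hsd
      (g₁ := fun v => q x (T.c k (check x) v))
      (g₂ := fun v => (-1 : ℂ) ^ (k : ℕ) • T.c k x (q (x + delta k) v))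
      (by fun_prop) (by fun_prop) (fun i => ?_) hv
    have h7 := h1 i
    have hε : phase' k (check x) ≠ 0 := by
      rw [← norm_ne_zero_iff, norm_phase']
      exact one_ne_zero
    have h2' : (T.checkWeight x : ℂ) * T.deltaWeight k (check x)
      = T.deltaWeight k x * T.checkWeight (x + delta k) := by exact_mod_cast h2
    simp only [transport, shift_apply, check_add_delta, h6, h5, map_smulₛₗ, RingHom.id_apply,
      Complex.conj_ofReal, smul_smul, ← conj_phase'_check k x, map_mul] at h7
    -- The common scalar to cancel: weights, conjugated phase, and the factor `h` of `e i` at `x̌ +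
    -- δᵏ`.
    have hb : (T.checkWeight x : ℂ) * T.deltaWeight k (check x) * (starRingEnd ℂ) (phase' k (check x))
        * (h (check x + delta k) : ℂ) ≠ 0 :=
      mul_ne_zero (mul_ne_zero (mul_ne_zero h3 h4) ((map_ne_zero _).2 hε)) (hh _)
    refine smul_right_injective K hb ?_
    simp only [smul_smul]
    convert h7 using 2
    · ring
    · linear_combination ((starRingEnd ℂ) (phase' k (check x)) *
        (h (check x + delta k) : ℂ) * (-1) ^ (k : ℕ)) * h2'

end IsInvariantQuaternionicStructure

/-- The operators `q x` and `q (check x)` are injective and antilinear in opposite directions, so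
each rank bounds the other. -/
theorem IsQuaternionicField.ν_check {K : Type u} [NormedAddCommGroup K] [InnerProductSpace ℂ K]
    [CompleteSpace K] {T : Triple K} {q : X → K →L⋆[ℂ] K}
    (hq : T.IsQuaternionicField q) (hac : checkMeasure T.μ ≪ T.μ) :
    ∀ᵐ x ∂T.μ, T.ν (check x) = T.ν x := by
  filter_upwards [hq.mapsTo, hq.norm_map, T.ae_check hac hq.mapsTo, T.ae_check hac hq.norm_map]
    with x h1 h2 h3 h4
  rw [check_check] at h3 h4
  rw [ν, ν, le_antisymm (rank_le_of_antilinear_isometry h1 h2)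
    (rank_le_of_antilinear_isometry h3 h4)]

end Triple

end Spinor

end

theorem theorem3p10 {K : Type*} [NormedAddCommGroup K] [InnerProductSpace ℂ K] [CompleteSpace K]
    [SecondCountableTopology K] (T : Spinor.Triple K) :
    (∃ Q : T.Space →ₗ⋆[ℂ] T.Space, T.IsInvariantQuaternionicStructure Q) ↔
      (Spinor.MeasEquiv T.μ (Spinor.checkMeasure T.μ) ∧
        (∀ᵐ x ∂T.μ, T.ν (Spinor.check x) = T.ν x) ∧
        ∃ q : Spinor.X → K →L⋆[ℂ] K, T.IsQuaternionicField q) := by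
  constructor
  · rintro ⟨Q, hQ⟩
    obtain ⟨q, hq⟩ := hQ.exists_isQuaternionicField
    exact ⟨hQ.measEquiv_check, hq.ν_check hQ.measEquiv_check.2, q, hq⟩
  · rintro ⟨hμ, -, q, hq⟩
    exact ⟨_, hq.isInvariantQuaternionicStructure hμ.2⟩
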